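/- Consider a bandit with $K\ge 1$ arms and horizon $T\ge 2$. An environment is a family of probability distributions $(f_t^k)_{1\le t\le T,\,1\le k\le K}$ on $\mathbb{R}$; the rewards $X_t^k\sim f_t^k$ are independent, with means $\mu_t^k$. For $a\in\mathbb{R}$, $b>0$ and a variation budget $V_T>0$, let $\mathcal{E}(V_T,T,K)$ be the class of environments such that every $f_t^k$ is $1/2$ sub-Gaussian, i.e. $\mathbb{E}[e^{\lambda(X_t^k-\mu_t^k)}]\le e^{\lambda^2/8}$ for all $\lambda\in\mathbb{R}$, every $\mu_t^k$ lies in $[a,a+b]$, and $\sum_{t=1}^{T-1}\max_k|\mu_{t+1}^k-\mu_t^k|\le V_T$. The regret of a policy selecting the arms $\varphi_1,\dots,\varphi_T$ is $R_T=\sum_{t=1}^T\max_k\mu_t^k-\mathbb{E}\big[\sum_{t=1}^T X_t^{\varphi_t}\big]$. Let $\tau=\lceil K^{1/3}(T/V_T)^{2/3}\rceil$ and $\gamma=1-K^{-1/3}(T/V_T)^{-2/3}$. Discounted UCB (D-UCB) with exploration constant $\xi$ selects arm $t$ in slot $t$ for $t\le K$, and in every slot $t>K$ an arm $k$ that maximizes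 $$\hat\mu_t^k+2\sqrt{\frac{\xi\ln\tau}{n_t^k}},\qquad n_t^k=\sum_{s=1}^{t-1}\gamma^{t-s}\mathbf 1\{\varphi_s=k\},\qquad \hat\mu_t^k=\frac1{n_t^k}\sum_{s=1}^{t-1}\gamma^{t-s}\mathbf 1\{\varphi_s=k\}X_s^{\varphi_s},$$ ties being broken by an arbitrary measurable function of the past observations; the version in which the weights $\gamma^{t-s}$ are replaced by $\gamma^{t-1-s}$ is allowed as well. (If $\gamma\le 0$, quotients with denominator $0$ and square roots of negative numbers are read as $0$.) Theorem. For every $\xi>1/2$ and $b>0$ there is a constant $C>0$, depending only on $\xi$ and $b$, such that for all $K\ge1$, $T\ge2$, $a\in\mathbb{R}$ and all $V_T>0$ with $\tau\le T$ (equivalently $V_T\ge\sqrt{K/T}$), the worst-case regret of D-UCB satisfies $$\sup_{\mathcal{E}(V_T,T,K)}R_T^{\text{D-UCB}}\le C\,\ln(T)\,(KV_T)^{1/3}\,T^{2/3}.$$ -/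

import Mathlib

open MeasureTheory ProbabilityTheory

namespace Bandit

noncomputable section

/-- An environment with `K` arms and horizon `T`: one reward distribution for every time slot and
arm. Slots and arms are numbered from `0`. -/
abbrev Environment (K T : ℕ) : Type := Fin T → Fin K → ProbabilityMeasure ℝ

/-- The mean reward of arm `k` in slot `t`. -/
def mean {K T : ℕ} (F : Environment K T) (t : Fin T) (k : Fin K) : ℝ :=
  ∫ y, y ∂(F t k : Measure ℝ)

/-- The mean reward of the best arm in slot `t`. -/
def bestMean {K T : ℕ} (F : Environment K T) (t : Fin T) : ℝ :=
  ⨆ k : Fin K, mean F t k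

/-- The total variation: the sum over consecutive slots of the largest change of a mean. -/
def totalVariation {K T : ℕ} (F : Environment K T) : ℝ :=
  ∑ t : Fin (T - 1), ⨆ k : Fin K,
    |mean F ⟨t + 1, by omega⟩ k - mean F ⟨t, by omega⟩ k|

/-- Every reward is `1/2` sub-Gaussian, that is `E exp (l (X - E X)) ≤ exp (l ^ 2 / 8)` for all
real `l` (variance proxy `1/4`), and every mean lies in `[a, a + b]`. -/
def IsSubGaussianEnv {K T : ℕ} (a b : ℝ) (F : Environment K T) : Prop :=
  ∀ t k, HasSubgaussianMGF (fun y : ℝ => y - mean F t k) (1 / 4) (F t k : Measure ℝ) ∧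
    mean F t k ∈ Set.Icc a (a + b)

/-- The sub-Gaussian environments whose total variation is within the budget `V`. -/
def variationClass (a b V : ℝ) (T K : ℕ) : Set (Environment K T) :=
  {F | IsSubGaussianEnv a b F ∧ totalVariation F ≤ V}

/-- The joint law of all rewards: they are independent, that of arm `k` in slot `t` has
distribution `F t k`. -/
def rewardLaw {K T : ℕ} (F : Environment K T) : Measure (Fin T → Fin K → ℝ) :=
  Measure.pi fun t => Measure.pi fun k => (F t k : Measure ℝ)

/-- A deterministic policy: in slot `t` it selects an arm as a measurable function of the arms
selected and the rewards received in the slots before `t`. -/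
structure Policy (K : ℕ) where
  select : (t : ℕ) → (Fin t → Fin K × ℝ) → Fin K
  measurable_select : ∀ t, Measurable (select t)

/-- The pairs (selected arm, received reward) of the first `t` slots when `x s k` is the reward
that arm `k` offers in slot `s`. -/
def Policy.history {K T : ℕ} (ρ : Policy K) (x : Fin T → Fin K → ℝ) :
    (t : ℕ) → t ≤ T → (Fin t → Fin K × ℝ)
  | 0, _ => Fin.elim0
  | t + 1, h =>
    Fin.snoc (α := fun _ => Fin K × ℝ) (ρ.history x t (Nat.le_of_succ_le h))
      (ρ.select t (ρ.history x t (Nat.le_of_succ_le h)),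
        x ⟨t, h⟩ (ρ.select t (ρ.history x t (Nat.le_of_succ_le h))))

/-- The arm selected in slot `t`. -/
def Policy.arm {K T : ℕ} (ρ : Policy K) (x : Fin T → Fin K → ℝ) (t : Fin T) : Fin K :=
  ρ.select t (ρ.history x t t.2.le)

/-- The regret: total mean reward of the best arms minus expected cumulative reward. -/
def regret {K T : ℕ} (ρ : Policy K) (F : Environment K T) : ℝ :=
  ∑ t, bestMean F t - ∫ x, ∑ t, x t (ρ.arm x t) ∂(rewardLaw F)

/-- The supremum of the regret over the variation budget class. -/
def worstCaseRegret (a b V : ℝ) (T K : ℕ) (ρ : Policy K) : EReal :=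
  ⨆ F ∈ variationClass a b V T K, (regret ρ F : EReal)

/-- The number `τ = ⌈K ^ (1/3) (T / V) ^ (2/3)⌉`. -/
def epochLength (K T : ℕ) (V : ℝ) : ℕ :=
  ⌈(K : ℝ) ^ (1 / 3 : ℝ) * ((T : ℝ) / V) ^ (2 / 3 : ℝ)⌉₊

/-- The discount factor `γ = 1 - K ^ (-1/3) (T / V) ^ (-2/3)`. -/
def discount (K T : ℕ) (V : ℝ) : ℝ :=
  1 - (K : ℝ) ^ (-(1 / 3) : ℝ) * ((T : ℝ) / V) ^ (-(2 / 3) : ℝ)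

/-- The discounted number of selections of arm `k` in a history of `t` slots. The most recent
slot has weight `γ ^ e`: for `e = 1` the weight of slot `s` is `γ ^ (t - s)`, for `e = 0` it is
`γ ^ (t - 1 - s)`, as obtained from the update `n ← γ n`, then `n ← n + 1` for the selected arm. -/
def discountedCount {K : ℕ} (γ : ℝ) (e : ℕ) {t : ℕ} (h : Fin t → Fin K × ℝ) (k : Fin K) : ℝ :=
  ∑ s : Fin t, if (h s).1 = k then γ ^ (t - 1 - s + e) else 0

/-- The discounted empirical average of the rewards received from arm `k`. -/
def discountedMean {K : ℕ} (γ : ℝ) (e : ℕ) {t : ℕ} (h : Fin t → Fin K × ℝ) (k : Fin K) : ℝ :=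
  (∑ s : Fin t, if (h s).1 = k then γ ^ (t - 1 - s + e) * (h s).2 else 0) /
    discountedCount γ e h k

/-- The upper confidence bound of arm `k`: average plus twice the radius `√(ξ ln τ / n)`. -/
def ucbIndex {K : ℕ} (γ : ℝ) (e : ℕ) (ξ : ℝ) (τ : ℕ) {t : ℕ} (h : Fin t → Fin K × ℝ)
    (k : Fin K) : ℝ :=
  discountedMean γ e h k + 2 * √(ξ * Real.log τ / discountedCount γ e h k)

/-- `ρ` is Discounted UCB for `K` arms, horizon `T`, variation budget `V` and exploration
constant `ξ`: it selects every arm once in the first `K` slots, arm `t` in slot `t`, and an arm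
of maximal index in every later slot (ties are broken arbitrarily). -/
def IsDUCB {K : ℕ} (T : ℕ) (V ξ : ℝ) (e : ℕ) (ρ : Policy K) : Prop :=
  ∀ t < T, ∀ h : Fin t → Fin K × ℝ,
    (t < K → (ρ.select t h : ℕ) = t) ∧
    (K ≤ t → ∀ k, ucbIndex (discount K T V) e ξ (epochLength K T V) h k ≤
      ucbIndex (discount K T V) e ξ (epochLength K T V) h (ρ.select t h))

end

end Bandit

/-!
Let `γ` be the discount factor and `d = 1 - γ`, so that `τ = ⌈1 / d⌉`. Both `V / d` and `T √(K d)`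
equal the rate `(K V) ^ (1/3) T ^ (2/3)`, and it suffices to bound the regret by these two
quantities, up to a factor `ln T`.

The error of the discounted mean of an arm with discounted count `n` has two parts. Rewards that
are at most `D ≈ ln (1 / d) / d` slots old contribute a bias of at most the variation of the means
over the last `D` slots, and the total weight of the older ones is negligible. The noise is a sum of
sub-Gaussian variables with predictable weights; an exponential supermartingale and peeling over
the random count show that it exceeds `5/4 √(n ln τ)` with probability at most `6 / τ`. Off these
events the index rule makes the gap of the selected arm at most twice the windowed variation plus a
multiple of `√(ln τ / n)`. The windowed variations sum to at most `D V`. The bonuses are summed with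
the potential `∑ k, √(n k)`: it is at most `√(K / d)`, each selection of an arm with count `n`
raises it by about `1 / √n`, and discounting lowers it by at most `d √(K / d) = √(K d)` per slot.

If `√(K d) ≥ 1/8`, the trivial bound `b T` on the regret is enough.
-/

namespace Bandit

noncomputable section

section ProductMeasure

variable {ι : Type*} [Fintype ι] {Ω : ι → Type*} [∀ i, MeasurableSpace (Ω i)]
  (μ : ∀ i, Measure (Ω i)) [∀ i, IsProbabilityMeasure (μ i)]

theorem measurePreserving_update [DecidableEq ι] (i : ι) :
    MeasurePreserving (fun p : (∀ j, Ω j) × Ω i => Function.update p.1 i p.2)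
      ((Measure.pi μ).prod (μ i)) (Measure.pi μ) := by
  refine ⟨measurable_update', (Measure.pi_eq fun s hs => ?_).symm⟩
  have hpre : (fun p : (∀ j, Ω j) × Ω i => Function.update p.1 i p.2) ⁻¹' Set.univ.pi s =
      Set.univ.pi (Function.update s i Set.univ) ×ˢ s i := by
    ext p
    simp only [Set.mem_preimage, Set.mem_univ_pi, Set.mem_prod,
      Function.forall_update_iff p.1 fun j y => y ∈ s j,
      Function.forall_update_iff s fun j S => p.1 j ∈ S, Set.mem_univ, true_and, and_comm]
  rw [Measure.map_apply measurable_update' (.univ_pi hs), hpre, Measure.prod_prod, Measure.pi_pi]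
  simp only [Function.apply_update (fun j S => μ j S), measure_univ]
  rw [Finset.prod_update_of_mem (Finset.mem_univ i), one_mul, mul_comm,
    Finset.prod_eq_mul_prod_sdiff_singleton_of_mem (Finset.mem_univ i)]

theorem integral_resample [DecidableEq ι] (i : ι) {E : Type*} [NormedAddCommGroup E]
    [NormedSpace ℝ E] {f : (∀ j, Ω j) → E} (hf : Integrable f (Measure.pi μ)) :
    ∫ x, f x ∂Measure.pi μ = ∫ x, ∫ y, f (Function.update x i y) ∂μ i ∂Measure.pi μ := by
  have h := measurePreserving_update μ i
  calc ∫ x, f x ∂Measure.pi μ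
      = ∫ p, f (Function.update p.1 i p.2) ∂(Measure.pi μ).prod (μ i) := by
        conv_lhs => rw [← h.map_eq]
        exact integral_map h.aemeasurable (h.map_eq.symm ▸ hf.aestronglyMeasurable)
    _ = _ := integral_prod _ (h.integrable_comp_of_integrable hf)

theorem lintegral_prod_le_one [LinearOrder ι] {g : ι → (∀ i, Ω i) → ENNReal}
    (hg : ∀ i, Measurable (g i))
    (hpast : ∀ i j, i < j → ∀ x y, g i (Function.update x j y) = g i x)
    (hone : ∀ i x, ∫⁻ y, g i (Function.update x i y) ∂μ i ≤ 1) (s : Finset ι) :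
    ∫⁻ x, ∏ i ∈ s, g i x ∂Measure.pi μ ≤ 1 := by
  induction s using Finset.induction_on_max with
  | empty => simp
  | insert m s hlt ih =>
    have hprod : ∀ s : Finset ι, Measurable fun x => ∏ i ∈ s, g i x := fun s =>
      Finset.measurable_prod s fun i _ => hg i
    refine (lintegral_le_of_lmarginal_le {m} (hprod _) (hprod s) ?_).trans ih
    intro x
    have hm : Measurable fun y => g m (Function.update x m y) := (hg m).comp (measurable_update x)
    simp only [lmarginal_singleton, Finset.prod_insert fun h => (hlt m h).false,
      fun y => Finset.prod_congr rfl fun i hi => hpast i m (hlt i hi) x y]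
    rw [lintegral_mul_const _ hm, lintegral_const, measure_univ, mul_one]
    exact mul_le_of_le_one_left' (hone m x)

theorem lintegral_exp_sub_le_one {Ω : Type*} [MeasurableSpace Ω] {P : Measure Ω} {X : Ω → ℝ}
    {c : NNReal} (h : HasSubgaussianMGF X c P) (l : ℝ) :
    ∫⁻ ω, ENNReal.ofReal (Real.exp (l * X ω - c * l ^ 2 / 2)) ∂P ≤ 1 := by
  simp only [Real.exp_sub, div_eq_mul_inv]
  rw [← ofReal_integral_eq_lintegral_ofReal ((h.integrable_exp_mul l).mul_const _)
    (Filter.Eventually.of_forall fun y => by positivity), integral_mul_const]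
  refine ENNReal.ofReal_le_one.2 (mul_inv_le_one_of_le₀ ?_ (Real.exp_pos _).le)
  simpa only [mgf, div_eq_mul_inv] using h.mgf_le l

end ProductMeasure

theorem integrable_apply_of_measurable {Ω κ : Type*} [MeasurableSpace Ω] {P : Measure Ω}
    [Finite κ] [MeasurableSpace κ] [MeasurableSingletonClass κ] {c : Ω → κ} (hc : Measurable c)
    {f : κ → Ω → ℝ} (hf : ∀ k, Integrable (f k) P) : Integrable (fun ω => f (c ω) ω) P := by
  classical
  cases nonempty_fintype κ
  have hsum := integrable_finsetSum Finset.univ fun k _ =>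
    (hf k).indicator (hc (measurableSet_singleton k))
  refine hsum.congr (.of_forall fun ω => ?_)
  simp [Set.indicator_apply]

section Path

variable {K T : ℕ} (ρ : Policy K)

theorem Policy.history_apply (x : Fin T → Fin K → ℝ) {t : ℕ} (ht : t ≤ T) (s : Fin t) :
    ρ.history x t ht s = (ρ.arm x (s.castLE ht), x (s.castLE ht) (ρ.arm x (s.castLE ht))) := by
  induction t with
  | zero => exact s.elim0
  | succ t ih =>
    cases s using Fin.lastCases with
    | last =>
      simp only [Policy.history, Fin.snoc_last]
      rfl
    | cast s =>
      simp only [Policy.history, Fin.snoc_castSucc]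
      exact ih (Nat.le_of_succ_le ht) s

theorem Policy.history_eq_take (x : Fin T → Fin K → ℝ) {t : ℕ} (ht : t ≤ T) :
    ρ.history x t ht = Fin.take t ht (ρ.history x T le_rfl) := by
  ext1 s
  rw [Fin.take_apply, ρ.history_apply, ρ.history_apply]
  rfl

theorem Policy.history_update (x : Fin T → Fin K → ℝ) (u : Fin T) (y : Fin K → ℝ) {t : ℕ}
    (ht : t ≤ T) (hu : t ≤ u) : ρ.history (Function.update x u y) t ht = ρ.history x t ht := by
  induction t with
  | zero => rfl
  | succ t ih =>
    have hne : (⟨t, ht⟩ : Fin T) ≠ u := Fin.ne_of_lt hu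
    simp only [Policy.history, ih (Nat.le_of_succ_le ht) (Nat.le_of_succ_le hu),
      Function.update_of_ne hne]

theorem Policy.arm_update (x : Fin T → Fin K → ℝ) {u t : Fin T} (y : Fin K → ℝ) (h : t ≤ u) :
    ρ.arm (Function.update x u y) t = ρ.arm x t := by
  rw [Policy.arm, ρ.history_update x u y _ h, Policy.arm]

theorem Policy.measurable_history {t : ℕ} (ht : t ≤ T) :
    Measurable fun x : Fin T → Fin K → ℝ => ρ.history x t ht := by
  induction t with
  | zero => exact measurable_const
  | succ t ih =>
    have hpast := ih (Nat.le_of_succ_le ht)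
    have harm := (ρ.measurable_select t).comp hpast
    have heval : Measurable fun p : (Fin K → ℝ) × Fin K => p.1 p.2 :=
      measurable_from_prod_countable_left fun k => measurable_pi_apply k
    refine measurable_pi_iff.2 fun s => ?_
    cases s using Fin.lastCases with
    | last =>
      simp only [Policy.history, Fin.snoc_last]
      exact harm.prodMk (heval.comp ((measurable_pi_apply _).prodMk harm))
    | cast s =>
      simp only [Policy.history, Fin.snoc_castSucc]
      exact (measurable_pi_apply s).comp hpast

theorem Policy.measurable_arm (t : Fin T) :
    Measurable fun x : Fin T → Fin K → ℝ => ρ.arm x t :=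
  (ρ.measurable_select t).comp (ρ.measurable_history t.2.le)

end Path

section Regret

variable {K T : ℕ} (F : Environment K T)

instance : IsProbabilityMeasure (rewardLaw F) := by
  unfold rewardLaw; infer_instance

theorem measurePreserving_reward (t : Fin T) (k : Fin K) :
    MeasurePreserving (fun x : Fin T → Fin K → ℝ => x t k) (rewardLaw F) (F t k) :=
  (measurePreserving_eval (fun k => (F t k : Measure ℝ)) k).comp
    (measurePreserving_eval (fun t => Measure.pi fun k => (F t k : Measure ℝ)) t)

variable {F} (ρ : Policy K)

theorem integrable_mean_arm (t : Fin T) :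
    Integrable (fun x => mean F t (ρ.arm x t)) (rewardLaw F) :=
  integrable_apply_of_measurable (ρ.measurable_arm t) fun _ => integrable_const _

theorem integrable_gap (t : Fin T) :
    Integrable (fun x => bestMean F t - mean F t (ρ.arm x t)) (rewardLaw F) :=
  (integrable_const _).sub (integrable_mean_arm ρ t)

theorem integrable_reward {t : Fin T} (hF : ∀ k, Integrable id (F t k : Measure ℝ)) :
    Integrable (fun x => x t (ρ.arm x t)) (rewardLaw F) :=
  integrable_apply_of_measurable (ρ.measurable_arm t) fun k =>
    (measurePreserving_reward F t k).integrable_comp_of_integrable (hF k)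

theorem integral_reward {t : Fin T} (hF : ∀ k, Integrable id (F t k : Measure ℝ)) :
    ∫ x, x t (ρ.arm x t) ∂rewardLaw F = ∫ x, mean F t (ρ.arm x t) ∂rewardLaw F := by
  rw [rewardLaw, integral_resample _ t (integrable_reward ρ hF)]
  simp only [ρ.arm_update _ _ le_rfl, Function.update_self]
  congr with x
  exact integral_comp_eval (μ := fun k => (F t k : Measure ℝ)) (hF _).aestronglyMeasurable

theorem regret_eq_integral_gap (hF : ∀ t k, Integrable id (F t k : Measure ℝ)) :
    regret ρ F = ∫ x, ∑ t, (bestMean F t - mean F t (ρ.arm x t)) ∂rewardLaw F := by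
  rw [regret, integral_finsetSum _ fun t _ => integrable_reward ρ (hF t),
    integral_finsetSum _ fun t _ => integrable_gap ρ t, ← Finset.sum_sub_distrib]
  refine Finset.sum_congr rfl fun t _ => ?_
  rw [integral_reward ρ (hF t), integral_sub (integrable_const _) (integrable_mean_arm ρ t)]
  simp

variable {a b : ℝ}

theorem IsSubGaussianEnv.integrable (hF : IsSubGaussianEnv a b F) (t : Fin T) (k : Fin K) :
    Integrable id (F t k : Measure ℝ) := by
  have hsum := (hF t k).1.integrable.add (integrable_const (mean F t k))
  exact hsum.congr (.of_forall fun y => sub_add_cancel y _)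

theorem IsSubGaussianEnv.bestMean_sub_mean_le (hF : IsSubGaussianEnv a b F) (t : Fin T)
    (k : Fin K) : bestMean F t - mean F t k ≤ b := by
  have : Nonempty (Fin K) := ⟨k⟩
  have hbest : bestMean F t ≤ a + b := ciSup_le fun j => (hF t j).2.2
  linarith [(hF t k).2.1]

theorem regret_le_mul (hF : IsSubGaussianEnv a b F) : regret ρ F ≤ b * T := by
  rw [regret_eq_integral_gap ρ hF.integrable]
  calc ∫ x, ∑ t, (bestMean F t - mean F t (ρ.arm x t)) ∂rewardLaw F
      ≤ ∫ _, ∑ _t : Fin T, b ∂rewardLaw F :=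
        integral_mono (integrable_finsetSum _ fun t _ => integrable_gap ρ t)
          (integrable_const _) fun x => Finset.sum_le_sum fun t _ =>
            hF.bestMean_sub_mean_le t _
    _ = b * T := by simp [mul_comm]

end Regret

section Count

variable {K t : ℕ}

/-- The weight of slot `s` in `discountedCount γ e h k` and `discountedMean γ e h k`. -/
def discountedWeight (γ : ℝ) (e : ℕ) (h : Fin t → Fin K × ℝ) (k : Fin K) (s : Fin t) : ℝ :=
  if (h s).1 = k then γ ^ (t - 1 - s + e) else 0

theorem discountedCount_eq_sum (γ : ℝ) (e : ℕ) (h : Fin t → Fin K × ℝ) (k : Fin K) :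
    discountedCount γ e h k = ∑ s, discountedWeight γ e h k s :=
  rfl

theorem discountedWeight_sq (γ : ℝ) (e : ℕ) (h : Fin t → Fin K × ℝ) (k : Fin K) (s : Fin t) :
    discountedWeight (γ ^ 2) e h k s = discountedWeight γ e h k s ^ 2 := by
  unfold discountedWeight
  split_ifs
  · exact pow_right_comm γ 2 _
  · exact (zero_pow two_ne_zero).symm

theorem discountedCount_succ (γ : ℝ) (e : ℕ) (h : Fin (t + 1) → Fin K × ℝ) (k : Fin K) :
    discountedCount γ e h k = γ * discountedCount γ e (Fin.init h) k +
      if (h (Fin.last t)).1 = k then γ ^ e else 0 := by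
  have hexp : ∀ s : Fin t, t + 1 - 1 - s + e = t - 1 - s + e + 1 := by omega
  rw [discountedCount, Fin.sum_univ_castSucc, discountedCount, Finset.mul_sum]
  refine congrArg₂ (· + ·) (Finset.sum_congr rfl fun s _ => ?_) (by simp)
  rw [mul_ite, mul_zero, ← pow_succ', Fin.val_castSucc, hexp]
  rfl

variable {γ : ℝ} {e : ℕ}

theorem discountedWeight_nonneg (hγ : 0 ≤ γ) (h : Fin t → Fin K × ℝ) (k : Fin K) (s : Fin t) :
    0 ≤ discountedWeight γ e h k s := by
  unfold discountedWeight
  split_ifs <;> positivity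

theorem discountedWeight_le_one (hγ0 : 0 ≤ γ) (hγ1 : γ ≤ 1) (h : Fin t → Fin K × ℝ) (k : Fin K)
    (s : Fin t) : discountedWeight γ e h k s ≤ 1 := by
  unfold discountedWeight
  split_ifs
  exacts [pow_le_one₀ hγ0 hγ1, zero_le_one]

theorem discountedCount_nonneg (hγ : 0 ≤ γ) (h : Fin t → Fin K × ℝ) (k : Fin K) :
    0 ≤ discountedCount γ e h k :=
  Finset.sum_nonneg fun s _ => discountedWeight_nonneg hγ h k s

theorem discountedCount_pos (hγ : 0 < γ) {h : Fin t → Fin K × ℝ} {k : Fin K} {s : Fin t}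
    (hs : (h s).1 = k) : 0 < discountedCount γ e h k :=
  Finset.sum_pos' (fun s _ => discountedWeight_nonneg hγ.le h k s)
    ⟨s, Finset.mem_univ s, by rw [if_pos hs]; positivity⟩

theorem discountedCount_eq_zero {h : Fin t → Fin K × ℝ} {k : Fin K} (hk : ∀ s, (h s).1 ≠ k) :
    discountedCount γ e h k = 0 :=
  Finset.sum_eq_zero fun s _ => if_neg (hk s)

theorem discountedCount_sq_le (hγ0 : 0 ≤ γ) (hγ1 : γ ≤ 1) (h : Fin t → Fin K × ℝ) (k : Fin K) :
    discountedCount (γ ^ 2) e h k ≤ discountedCount γ e h k := by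
  simp only [discountedCount_eq_sum, discountedWeight_sq]
  exact Finset.sum_le_sum fun s _ => pow_le_of_le_one (discountedWeight_nonneg hγ0 h k s)
    (discountedWeight_le_one hγ0 hγ1 h k s) two_ne_zero

theorem discountedCount_sq_le_sq (hγ : 0 ≤ γ) (h : Fin t → Fin K × ℝ) (k : Fin K) :
    discountedCount (γ ^ 2) e h k ≤ discountedCount γ e h k ^ 2 := by
  simp only [discountedCount_eq_sum, discountedWeight_sq]
  exact Finset.sum_sq_le_sq_sum_of_nonneg fun s _ => discountedWeight_nonneg hγ h k s

theorem sum_discountedCount_le (hγ0 : 0 ≤ γ) (hγ1 : γ < 1) (h : Fin t → Fin K × ℝ) :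
    ∑ k, discountedCount γ e h k ≤ 1 / (1 - γ) := by
  have hγ : 0 < 1 - γ := sub_pos.2 hγ1
  induction t with
  | zero => simpa [discountedCount] using hγ1.le
  | succ t ih =>
    calc ∑ k, discountedCount γ e h k
        = γ * ∑ k, discountedCount γ e (Fin.init h) k + γ ^ e := by
          simp [discountedCount_succ, Finset.sum_add_distrib, Finset.mul_sum]
      _ ≤ γ * (1 / (1 - γ)) + 1 := by
          gcongr
          exacts [ih _, pow_le_one₀ hγ0 hγ1.le]
      _ = 1 / (1 - γ) := by field_simp; ring

theorem discountedCount_le (hγ0 : 0 ≤ γ) (hγ1 : γ < 1) (h : Fin t → Fin K × ℝ) (k : Fin K) :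
    discountedCount γ e h k ≤ 1 / (1 - γ) :=
  (Finset.single_le_sum (fun k _ => discountedCount_nonneg hγ0 h k) (Finset.mem_univ k)).trans
    (sum_discountedCount_le hγ0 hγ1 h)

theorem sum_sqrt_discountedCount_le (hγ0 : 0 ≤ γ) (hγ1 : γ < 1) (h : Fin t → Fin K × ℝ) :
    ∑ k, √(discountedCount γ e h k) ≤ √(K / (1 - γ)) := by
  refine Real.le_sqrt_of_sq_le ?_
  calc (∑ k, √(discountedCount γ e h k)) ^ 2
      ≤ K * ∑ k, √(discountedCount γ e h k) ^ 2 := by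
        simpa using sq_sum_le_card_mul_sum_sq (s := (Finset.univ : Finset (Fin K)))
          (f := fun k => √(discountedCount γ e h k))
    _ = K * ∑ k, discountedCount γ e h k := by
        simp only [Real.sq_sqrt (discountedCount_nonneg hγ0 h _)]
    _ ≤ K * (1 / (1 - γ)) := by gcongr; exact sum_discountedCount_le hγ0 hγ1 h
    _ = K / (1 - γ) := mul_one_div _ _

theorem sqrt_add_one_div_sqrt_le {n : ℝ} (hn : 0 ≤ n) :
    √n + 1 / √(n + 1) / 2 ≤ √(n + 1) := by
  have hpos : 0 < √(n + 1) := by positivity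
  have hsq : √n * √(n + 1) ≤ n + 1 / 2 := by
    rw [← Real.sqrt_mul hn]
    exact Real.sqrt_le_iff.2 ⟨by positivity, by nlinarith⟩
  refine le_of_mul_le_mul_right ?_ hpos
  rw [add_mul, Real.mul_self_sqrt (by positivity), div_right_comm, div_mul_cancel₀ _ hpos.ne']
  linarith

theorem one_div_sqrt_discountedCount_le (hγ0 : 1 / 2 ≤ γ) (hγ1 : γ ≤ 1) (he : e ≤ 1)
    (h : Fin (t + 1) → Fin K × ℝ) :
    1 / √(discountedCount γ e (Fin.init h) (h (Fin.last t)).1 + 1) ≤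
      4 * (∑ k, √(discountedCount γ e h k) -
        √γ * ∑ k, √(discountedCount γ e (Fin.init h) k)) := by
  have hγ : 0 ≤ γ := by linarith
  have hsqrt : 1 / 2 ≤ √γ := Real.le_sqrt_of_sq_le (by linarith)
  have hpow : γ ≤ γ ^ e := by simpa only [pow_one] using pow_le_pow_of_le_one hγ hγ1 he
  have hstep : ∀ k, √γ * √(discountedCount γ e (Fin.init h) k) +
      (if (h (Fin.last t)).1 = k then 1 / √(discountedCount γ e (Fin.init h) k + 1) / 4 else 0) ≤
        √(discountedCount γ e h k) := by
    intro k
    have hn := discountedCount_nonneg (e := e) hγ (Fin.init h) k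
    rw [discountedCount_succ]
    generalize discountedCount γ e (Fin.init h) k = n at *
    split_ifs
    · calc √γ * √n + 1 / √(n + 1) / 4
          = √γ * √n + 1 / 2 * (1 / √(n + 1) / 2) := by ring
        _ ≤ √γ * √n + √γ * (1 / √(n + 1) / 2) := by gcongr
        _ = √γ * (√n + 1 / √(n + 1) / 2) := by ring
        _ ≤ √γ * √(n + 1) := by gcongr; exact sqrt_add_one_div_sqrt_le hn
        _ = √(γ * n + γ) := by rw [← Real.sqrt_mul hγ, mul_add_one]
        _ ≤ √(γ * n + γ ^ e) := by gcongr
    · rw [add_zero, add_zero, Real.sqrt_mul hγ]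
  have hsum := Finset.sum_le_sum fun k (_ : k ∈ Finset.univ) => hstep k
  rw [Finset.sum_add_distrib, ← Finset.mul_sum, Finset.sum_ite_eq,
    if_pos (Finset.mem_univ _)] at hsum
  linarith

theorem sum_one_div_sqrt_discountedCount_take_le (hγ0 : 1 / 2 ≤ γ) (hγ1 : γ < 1) (he : e ≤ 1)
    (h : Fin t → Fin K × ℝ) :
    ∑ s : Fin t, 1 / √(discountedCount γ e (Fin.take s s.2.le h) (h s).1 + 1) ≤
      4 * (√(K / (1 - γ)) + t * √(K * (1 - γ))) := by
  have hγ : 0 ≤ γ := by linarith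
  have hd : 0 < 1 - γ := sub_pos.2 hγ1
  have hscale : (1 - γ) * √(K / (1 - γ)) = √(K * (1 - γ)) := by
    rw [← Real.sqrt_sq hd.le, ← Real.sqrt_mul (sq_nonneg _), Real.sqrt_sq hd.le]
    congr 1
    field_simp
  have hsqrt : γ ≤ √γ := Real.le_sqrt_of_sq_le (by nlinarith)
  suffices hpot : ∑ s : Fin t, 1 / √(discountedCount γ e (Fin.take s s.2.le h) (h s).1 + 1) ≤
      4 * (∑ k, √(discountedCount γ e h k) + t * √(K * (1 - γ))) by
    linarith [sum_sqrt_discountedCount_le (e := e) hγ hγ1 h]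
  induction t with
  | zero => simp [discountedCount]
  | succ t ih =>
    have hdecay : (1 - √γ) * ∑ k, √(discountedCount γ e (Fin.init h) k) ≤ √(K * (1 - γ)) := by
      rw [← hscale]
      exact mul_le_mul (by linarith) (sum_sqrt_discountedCount_le hγ hγ1 _)
        (Finset.sum_nonneg fun k _ => Real.sqrt_nonneg _) hd.le
    have hpast := ih (Fin.init h)
    have hstep := one_div_sqrt_discountedCount_le hγ0 hγ1.le he h
    rw [Fin.sum_univ_castSucc]
    push_cast
    change _ + 1 / √(discountedCount γ e (Fin.init h) (h (Fin.last t)).1 + 1) ≤ _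
    refine (add_le_add hpast hstep).trans ?_
    linarith

end Count

section Variation

theorem sum_sum_Ico_sub_le {δ : ℕ → ℝ} (hδ : ∀ u, 0 ≤ δ u) (D T : ℕ) :
    ∑ t ∈ Finset.range T, ∑ u ∈ Finset.Ico (t - D) t, δ u ≤
      D * ∑ u ∈ Finset.range (T - 1), δ u := by
  have hswap := Finset.sum_comm' (s := Finset.range T) (t := fun t => Finset.Ico (t - D) t)
    (t' := Finset.range (T - 1)) (s' := fun u => Finset.Ico (u + 1) (min (u + D + 1) T))
    (f := fun _ u => δ u) fun t u => by
      simp only [Finset.mem_range, Finset.mem_Ico]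
      omega
  rw [hswap, Finset.mul_sum]
  refine Finset.sum_le_sum fun u _ => ?_
  rw [Finset.sum_const, nsmul_eq_mul, Nat.card_Ico]
  refine mul_le_mul_of_nonneg_right (Nat.cast_le.2 ?_) (hδ u)
  omega

variable {K T : ℕ} (F : Environment K T)

/-- The largest change of a mean between the slots `u` and `u + 1`, and `0` from the last slot
on. -/
def variation (u : ℕ) : ℝ :=
  if h : u + 1 < T then ⨆ k : Fin K, |mean F ⟨u + 1, h⟩ k - mean F ⟨u, by omega⟩ k| else 0

/-- The total variation over the `D` slots before slot `t`, which bounds the bias of an average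
of the rewards received in these slots. -/
def windowVariation (D t : ℕ) : ℝ :=
  ∑ u ∈ Finset.Ico (t - D) t, variation F u

theorem variation_nonneg (u : ℕ) : 0 ≤ variation F u := by
  unfold variation
  split_ifs
  exacts [Real.iSup_nonneg fun _ => abs_nonneg _, le_rfl]

theorem windowVariation_nonneg (D t : ℕ) : 0 ≤ windowVariation F D t :=
  Finset.sum_nonneg fun _ _ => variation_nonneg F _

theorem sum_range_variation : ∑ u ∈ Finset.range (T - 1), variation F u = totalVariation F := by
  rw [totalVariation, ← Fin.sum_univ_eq_sum_range]
  exact Finset.sum_congr rfl fun u _ => dif_pos (by omega)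

theorem sum_windowVariation_le (D : ℕ) :
    ∑ t : Fin T, windowVariation F D t ≤ D * totalVariation F := by
  rw [Fin.sum_univ_eq_sum_range (windowVariation F D), ← sum_range_variation]
  exact sum_sum_Ico_sub_le (variation_nonneg F) D T

theorem abs_mean_sub_mean_le_variation {u : ℕ} (hu : u + 1 < T) (k : Fin K) :
    |mean F ⟨u, by omega⟩ k - mean F ⟨u + 1, hu⟩ k| ≤ variation F u := by
  rw [variation, dif_pos hu, abs_sub_comm]
  exact le_ciSup (f := fun k => |mean F ⟨u + 1, hu⟩ k - mean F ⟨u, by omega⟩ k|)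
    (Finite.bddAbove_range _) k

theorem abs_mean_sub_mean_le_windowVariation {D : ℕ} {s t : Fin T} (hst : s ≤ t)
    (hD : t.1 ≤ s + D) (k : Fin K) : |mean F s k - mean F t k| ≤ windowVariation F D t := by
  let m : ℕ → ℝ := fun u => if h : u < T then mean F ⟨u, h⟩ k else 0
  have hm : ∀ u (h : u < T), m u = mean F ⟨u, h⟩ k := fun u h => dif_pos h
  calc |mean F s k - mean F t k|
      = dist (m s) (m t) := by rw [hm s s.2, hm t t.2, Real.dist_eq]
    _ ≤ ∑ u ∈ Finset.Ico s.1 t, variation F u :=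
        dist_le_Ico_sum_of_dist_le hst fun {u} _ hu => by
          rw [hm u (by omega), hm (u + 1) (by omega), Real.dist_eq]
          exact abs_mean_sub_mean_le_variation F (by omega) k
    _ ≤ windowVariation F D t :=
        Finset.sum_le_sum_of_subset_of_nonneg (Finset.Ico_subset_Ico_left (by omega))
          fun _ _ _ => variation_nonneg F _

end Variation

section Estimate

theorem abs_sum_mul_le_of_sum_filter_le {ι : Type*} (I : Finset ι) (old : ι → Prop)
    [DecidablePred old] {w δ : ι → ℝ} {v b ε : ℝ} (hv : 0 ≤ v) (hb : 0 ≤ b) (hε : 0 ≤ ε)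
    (hw : ∀ i ∈ I, 0 ≤ w i) (hall : ∀ i ∈ I, |δ i| ≤ b)
    (hnew : ∀ i ∈ I, ¬ old i → |δ i| ≤ v) (hold : ∑ i ∈ I with old i, w i ≤ ε ^ 2) :
    |∑ i ∈ I, w i * δ i| ≤ v * ∑ i ∈ I, w i + b * ε * √(∑ i ∈ I, w i) := by
  set O := ∑ i ∈ I with old i, w i with hO
  have hO_nonneg : 0 ≤ O := Finset.sum_nonneg fun i hi => hw i (Finset.mem_filter.1 hi).1
  have hO_sum : O ≤ ∑ i ∈ I, w i :=
    Finset.sum_le_sum_of_subset_of_nonneg (Finset.filter_subset _ _) fun i hi _ => hw i hi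
  have hsplit : |∑ i ∈ I, w i * δ i| ≤ v * ∑ i ∈ I, w i + b * O := by
    refine (Finset.abs_sum_le_sum_abs _ _).trans ?_
    rw [hO, Finset.sum_filter, Finset.mul_sum, Finset.mul_sum, ← Finset.sum_add_distrib]
    refine Finset.sum_le_sum fun i hi => ?_
    rw [abs_mul, abs_of_nonneg (hw i hi), mul_comm]
    split_ifs with h
    · exact le_add_of_nonneg_of_le (mul_nonneg hv (hw i hi))
        (mul_le_mul_of_nonneg_right (hall i hi) (hw i hi))
    · rw [mul_zero, add_zero]
      exact mul_le_mul_of_nonneg_right (hnew i hi h) (hw i hi)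
  have hO_le : O ≤ ε * √(∑ i ∈ I, w i) := by
    rw [← Real.mul_self_sqrt hO_nonneg]
    gcongr
    exact Real.sqrt_le_iff.2 ⟨hε, hold⟩
  linarith [mul_le_mul_of_nonneg_left hO_le hb]

variable {K t : ℕ} {γ : ℝ} {e : ℕ}

theorem sum_old_discountedWeight_le (hγ0 : 0 ≤ γ) (hγ1 : γ < 1) (D : ℕ)
    (h : Fin t → Fin K × ℝ) (k : Fin K) :
    ∑ s : Fin t with s.1 + D < t, discountedWeight γ e h k s ≤ γ ^ D / (1 - γ) := by
  have hage : ∀ s : Fin t, t - 1 - s = s.rev := fun s => by rw [Fin.val_rev]; omega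
  calc ∑ s : Fin t with s.1 + D < t, discountedWeight γ e h k s
      ≤ ∑ s : Fin t with s.1 + D < t, γ ^ (s.rev : ℕ) := by
        refine Finset.sum_le_sum fun s _ => ?_
        rw [discountedWeight, hage]
        split_ifs
        exacts [pow_le_pow_of_le_one hγ0 hγ1.le (Nat.le_add_right _ e), pow_nonneg hγ0 _]
    _ = ∑ s : Fin t with D ≤ s.1, γ ^ (s : ℕ) :=
        Finset.sum_equiv Fin.revPerm (by simp; omega) (by simp)
    _ = ∑ j ∈ Finset.Ico D t, γ ^ j := by
        refine Finset.sum_nbij Fin.val (by simp) Fin.val_injective.injOn ?_ (by simp)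
        intro j hj
        obtain ⟨hDj, hjt⟩ := Finset.mem_Ico.1 hj
        exact ⟨⟨j, hjt⟩, by simpa using hDj, rfl⟩
    _ ≤ γ ^ D / (1 - γ) := geom_sum_Ico_le_of_lt_one hγ0 hγ1

/-- The discounted sum of the deviations of the rewards received from arm `k` from their means,
where `m s k` stands for the mean reward of arm `k` in slot `s`. -/
def discountedNoise (γ : ℝ) (e : ℕ) (m : Fin t → Fin K → ℝ) (h : Fin t → Fin K × ℝ)
    (k : Fin K) : ℝ :=
  ∑ s, discountedWeight γ e h k s * ((h s).2 - m s k)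

theorem discountedMean_sub_eq (m : Fin t → Fin K → ℝ) {h : Fin t → Fin K × ℝ} {k : Fin K}
    (hn : discountedCount γ e h k ≠ 0) (c : ℝ) :
    discountedMean γ e h k - c = (discountedNoise γ e m h k +
      ∑ s, discountedWeight γ e h k s * (m s k - c)) / discountedCount γ e h k := by
  have hmean : discountedMean γ e h k =
      (∑ s, discountedWeight γ e h k s * (h s).2) / discountedCount γ e h k := by
    simp only [discountedMean, discountedWeight, ite_mul, zero_mul]
  rw [hmean, eq_div_iff hn, sub_mul, div_mul_cancel₀ _ hn, discountedNoise,
    ← Finset.sum_add_distrib, discountedCount_eq_sum, Finset.mul_sum, ← Finset.sum_sub_distrib]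
  exact Finset.sum_congr rfl fun s _ => by ring

end Estimate

section Gap

variable {K T : ℕ} {F : Environment K T} {a b γ : ℝ} {e D τ : ℕ}

theorem abs_sum_discountedWeight_mul_sub_le (hF : IsSubGaussianEnv a b F) (hb : 0 < b)
    (hγ0 : 0 ≤ γ) (hγ1 : γ < 1) (hD : γ ^ D / (1 - γ) ≤ (1 / (8 * b)) ^ 2) {t : Fin T}
    (h : Fin t → Fin K × ℝ) (k : Fin K) :
    |∑ s, discountedWeight γ e h k s * (mean F (s.castLE t.2.le) k - mean F t k)| ≤
      windowVariation F D t * discountedCount γ e h k + √(discountedCount γ e h k) / 8 := by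
  have hrange : ∀ s, |mean F s k - mean F t k| ≤ b := fun s => by
    rw [abs_sub_le_iff]
    constructor <;> linarith [(hF s k).2.1, (hF s k).2.2, (hF t k).2.1, (hF t k).2.2]
  have hrecent : ∀ s : Fin t, ¬ s.1 + D < t →
      |mean F (s.castLE t.2.le) k - mean F t k| ≤ windowVariation F D t := fun s hs =>
    abs_mean_sub_mean_le_windowVariation F (Fin.le_def.2 s.2.le) (not_lt.1 hs) k
  have hsplit := abs_sum_mul_le_of_sum_filter_le Finset.univ (fun s : Fin t => s.1 + D < t)
    (windowVariation_nonneg F D t) hb.le (by positivity : 0 ≤ 1 / (8 * b))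
    (fun s _ => discountedWeight_nonneg hγ0 h k s)
    (fun s _ => hrange (s.castLE t.2.le)) (fun s _ => hrecent s)
    ((sum_old_discountedWeight_le (e := e) hγ0 hγ1 D h k).trans hD)
  rw [← discountedCount_eq_sum] at hsplit
  refine hsplit.trans_eq (congrArg₂ _ rfl ?_)
  field_simp

theorem abs_discountedMean_sub_mean_le (hF : IsSubGaussianEnv a b F) (hb : 0 < b)
    (hγ0 : 0 ≤ γ) (hγ1 : γ < 1) (hD : γ ^ D / (1 - γ) ≤ (1 / (8 * b)) ^ 2) {t : Fin T}
    {h : Fin t → Fin K × ℝ} {k : Fin K} (hn : 0 < discountedCount γ e h k) {ξ L : ℝ}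
    (hξ : 1 / 2 ≤ ξ) (hL : 1 ≤ L)
    (hnoise : |discountedNoise γ e (fun s => mean F (s.castLE t.2.le)) h k| ≤
      5 / 4 * √(L * discountedCount γ e h k)) :
    |discountedMean γ e h k - mean F t k| ≤
      windowVariation F D t + 2 * √(ξ * L / discountedCount γ e h k) := by
  have hbias := abs_sum_discountedWeight_mul_sub_le (e := e) hF hb hγ0 hγ1 hD h k
  rw [discountedMean_sub_eq (fun s => mean F (s.castLE t.2.le)) hn.ne', abs_div,
    abs_of_pos hn, div_le_iff₀ hn]
  generalize discountedCount γ e h k = n at *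
  have hbonus : 11 / 8 * √(L * n) ≤ 2 * √(ξ * L / n) * n := by
    have hsq : √(ξ * L / n) * n = √(ξ * (L * n)) := by
      nth_rw 2 [← Real.sqrt_sq hn.le]
      rw [← Real.sqrt_mul (by positivity)]
      congr 1
      field_simp
    have hξ' : 11 / 16 ≤ √ξ := Real.le_sqrt_of_sq_le (by linarith)
    rw [mul_assoc, hsq, Real.sqrt_mul (show 0 ≤ ξ by linarith)]
    linarith [mul_le_mul_of_nonneg_right hξ' (Real.sqrt_nonneg (L * n))]
  have hsqrt : √n ≤ √(L * n) := Real.sqrt_le_sqrt (le_mul_of_one_le_left hn.le hL)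
  refine (abs_add_le _ _).trans ?_
  linarith

theorem bestMean_sub_mean_le_of_abs_sub_le {t : Fin T} {est radius : Fin K → ℝ} {v : ℝ}
    {j : Fin K} (hest : ∀ k, |est k - mean F t k| ≤ v + radius k)
    (hmax : ∀ k, est k + radius k ≤ est j + radius j) :
    bestMean F t - mean F t j ≤ 2 * v + 2 * radius j := by
  have : Nonempty (Fin K) := ⟨j⟩
  rw [sub_le_iff_le_add]
  refine ciSup_le fun k => ?_
  linarith [hmax k, abs_le.1 (hest k), abs_le.1 (hest j)]

/-- The selection rule of discounted UCB with discount factor `γ` and bonus `2 √(ξ ln τ / n)`,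
whose parameters are not tied to a variation budget as they are in `IsDUCB`. -/
def IsDiscountedUCB (γ : ℝ) (τ : ℕ) (ξ : ℝ) (e T : ℕ) (ρ : Policy K) : Prop :=
  ∀ t < T, ∀ h : Fin t → Fin K × ℝ,
    (t < K → (ρ.select t h : ℕ) = t) ∧
    (K ≤ t → ∀ k, ucbIndex γ e ξ τ h k ≤ ucbIndex γ e ξ τ h (ρ.select t h))

theorem sqrt_div_le_div_sqrt_add_one {n : ℝ} (hn : 1 ≤ n) (c : ℝ) :
    4 * √(c / n) ≤ 6 * √c / √(n + 1) := by
  have hn0 : 0 < n := by linarith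
  have hroot : 4 * √(n + 1) ≤ 6 * √n := by
    have hsq : √(n + 1) ≤ √((3 / 2) ^ 2 * n) := Real.sqrt_le_sqrt (by linarith)
    rw [Real.sqrt_mul (by positivity), Real.sqrt_sq (by norm_num)] at hsq
    linarith
  rw [Real.sqrt_div' _ hn0.le, ← mul_div_assoc, div_le_div_iff₀ (by positivity) (by positivity)]
  linarith [mul_le_mul_of_nonneg_right hroot (Real.sqrt_nonneg c)]

section Selection

variable {ξ : ℝ} {ρ : Policy K} (hρ : IsDiscountedUCB γ τ ξ e T ρ) (x : Fin T → Fin K → ℝ)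
  (t : Fin T)
include hρ

theorem IsDiscountedUCB.history_apply_fst (s : Fin t) (hs : s.1 < K) :
    ((ρ.history x t t.2.le s).1 : ℕ) = s := by
  rw [Policy.history_apply]
  exact (hρ s (s.2.trans t.2) _).1 hs

theorem IsDiscountedUCB.discountedCount_pos (hγ : 0 < γ) (ht : K ≤ t) (k : Fin K) :
    0 < discountedCount γ e (ρ.history x t t.2.le) k :=
  Bandit.discountedCount_pos hγ (s := ⟨k, k.2.trans_le ht⟩) <|
    Fin.ext (hρ.history_apply_fst x t _ k.2)

theorem IsDiscountedUCB.discountedCount_arm_eq_zero (ht : t < K) :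
    discountedCount γ e (ρ.history x t t.2.le) (ρ.arm x t) = 0 := by
  refine discountedCount_eq_zero fun s hs => ?_
  have harm : (ρ.arm x t : ℕ) = t := (hρ t t.2 _).1 ht
  rw [← hs, hρ.history_apply_fst x t s (s.2.trans ht)] at harm
  exact s.2.ne harm

theorem IsDiscountedUCB.bestMean_sub_mean_le (hF : IsSubGaussianEnv a b F) (hb : 0 < b)
    (hγ0 : 0 < γ) (hγ1 : γ < 1) (hD : γ ^ D / (1 - γ) ≤ (1 / (8 * b)) ^ 2) (hξ : 1 / 2 ≤ ξ)
    (hτ : 1 ≤ Real.log τ)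
    (hnoise : ∀ k, |discountedNoise γ e (fun s => mean F (s.castLE t.2.le))
        (ρ.history x t t.2.le) k| ≤
      5 / 4 * √(Real.log τ * discountedCount γ e (ρ.history x t t.2.le) k)) :
    bestMean F t - mean F t (ρ.arm x t) ≤ 2 * windowVariation F D t +
      (6 * √(ξ * Real.log τ) + 2 * b) *
        (1 / √(discountedCount γ e (ρ.history x t t.2.le) (ρ.arm x t) + 1)) := by
  have hv := windowVariation_nonneg F D t
  have hn := discountedCount_nonneg (e := e) hγ0.le (ρ.history x t t.2.le) (ρ.arm x t)
  set n := discountedCount γ e (ρ.history x t t.2.le) (ρ.arm x t)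
  rw [add_mul]
  rcases lt_or_ge n 1 with hn1 | hn1
  · have hroot : b ≤ 2 * b * (1 / √(n + 1)) := by
      have : √(n + 1) ≤ 2 := Real.sqrt_le_iff.2 ⟨by norm_num, by linarith⟩
      rw [mul_one_div, le_div_iff₀ (by positivity)]
      nlinarith
    have : 0 ≤ 6 * √(ξ * Real.log τ) * (1 / √(n + 1)) := by positivity
    linarith [hF.bestMean_sub_mean_le t (ρ.arm x t)]
  · have ht : K ≤ t := by
      by_contra! ht
      linarith [hρ.discountedCount_arm_eq_zero x t ht]
    have hgap := bestMean_sub_mean_le_of_abs_sub_le (F := F) (t := t)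
      (fun k => abs_discountedMean_sub_mean_le hF hb hγ0.le hγ1 hD
        (hρ.discountedCount_pos x t hγ0 ht k) hξ hτ (hnoise k))
      ((hρ t t.2 (ρ.history x t t.2.le)).2 ht)
    have hbonus := sqrt_div_le_div_sqrt_add_one hn1 (ξ * Real.log τ)
    have : 0 ≤ 2 * b * (1 / √(n + 1)) := by positivity
    rw [mul_one_div]
    change bestMean F t - mean F t (ρ.arm x t) ≤ _ + 2 * (2 * √(ξ * Real.log τ / n)) at hgap
    linarith

end Selection

end Gap

section SelfNormalized

/-- The exponent in the Chernoff bound with parameter `θ` for the event that a weighted sum of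
`1/2` sub-Gaussian variables reaches `s`, where `V` is the sum of the squared weights. -/
def chernoffExponent (θ s V : ℝ) : ℝ :=
  θ * s - θ ^ 2 * V / 8

theorem two_mul_le_chernoffExponent {L m n V s : ℝ} (hL : 0 ≤ L) (hm : 0 < m) (hmn : m ≤ n)
    (hnm : n ≤ 2 * m) (hV : V ≤ n) (hs : 5 / 4 * √(L * n) ≤ s) :
    2 * L ≤ chernoffExponent (4 * √(L / m)) s V := by
  have hn : 0 ≤ n := by linarith
  set p := √(n / m) with hp
  have hp2 : p ^ 2 = n / m := Real.sq_sqrt (by positivity)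
  have hp1 : 1 ≤ p := Real.one_le_sqrt.2 ((one_le_div hm).2 hmn)
  have hp3 : p ≤ 2 := Real.sqrt_le_iff.2 ⟨by norm_num, by rw [div_le_iff₀ hm]; linarith⟩
  have hlin : L * (5 * p) ≤ 4 * √(L / m) * s := by
    have hprod : √(L / m) * √(L * n) = L * p := by
      rw [← Real.sqrt_mul (by positivity), hp, ← Real.sqrt_sq hL, ← Real.sqrt_mul (sq_nonneg _),
        Real.sqrt_sq hL]
      congr 1
      ring
    linarith [mul_le_mul_of_nonneg_left hs (Real.sqrt_nonneg (L / m))]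
  have hquad : (4 * √(L / m)) ^ 2 * V / 8 ≤ L * (2 * p ^ 2) := by
    rw [mul_pow, Real.sq_sqrt (by positivity), hp2]
    calc 4 ^ 2 * (L / m) * V / 8 = L / m * (2 * V) := by ring
      _ ≤ L / m * (2 * n) := by gcongr
      _ = L * (2 * (n / m)) := by ring
  have hpoly : 2 ≤ 5 * p - 2 * p ^ 2 := by nlinarith
  unfold chernoffExponent
  linarith [mul_le_mul_of_nonneg_left hpoly hL]

theorem mul_le_chernoffExponent {L m n V s : ℝ} (hL : 0 ≤ L) (hm : 1 ≤ m) (hn : 0 ≤ n)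
    (hmn : m * n ≤ 1) (hnm : 1 ≤ (m + 1) * n) (hV : V ≤ n ^ 2) (hs : 5 / 4 * √(L * n) ≤ s) :
    m * L ≤ chernoffExponent (2 * m * √((m + 1) * L)) s V := by
  have hlin : 5 / 2 * m * L ≤ 2 * m * √((m + 1) * L) * s := by
    have hprod : L ≤ √((m + 1) * L) * √(L * n) := by
      rw [← Real.sqrt_mul (by positivity)]
      refine Real.le_sqrt_of_sq_le ?_
      nlinarith [mul_le_mul_of_nonneg_left hnm (sq_nonneg L)]
    have hs' := mul_le_mul_of_nonneg_left hs (Real.sqrt_nonneg ((m + 1) * L))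
    have := mul_le_mul_of_nonneg_left (hprod.trans (by linarith : _ ≤
      4 / 5 * (√((m + 1) * L) * s))) (by linarith : 0 ≤ m)
    linarith
  have hquad : (2 * m * √((m + 1) * L)) ^ 2 * V / 8 ≤ m * L := by
    have hmV : m ^ 2 * V ≤ 1 := by
      nlinarith [mul_le_mul_of_nonneg_left hV (sq_nonneg m), mul_nonneg (by linarith : 0 ≤ m) hn]
    rw [mul_pow, Real.sq_sqrt (by positivity)]
    nlinarith [mul_le_mul_of_nonneg_left hmV (by positivity : 0 ≤ (m + 1) * L)]
  unfold chernoffExponent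
  linarith [mul_nonneg (by linarith : 0 ≤ m) hL]

-- The Chernoff parameter must not depend on the random count `n`. It is computed from `⌊n⌋` if
-- `1 ≤ n`, which leaves `τ` candidates, and from `⌊1 / n⌋` if `n < 1`; the infinitely many
-- candidates of the second kind have summable failure probabilities because `V ≤ n ^ 2`.
theorem exists_le_chernoffExponent {L n V s : ℝ} {τ : ℕ} (hL : 0 ≤ L) (hn : 0 < n) (hτ : n ≤ τ)
    (hV1 : V ≤ n) (hV2 : V ≤ n ^ 2) (hs : 5 / 4 * √(L * n) ≤ s) :
    (∃ m ∈ Finset.Icc 1 τ, 2 * L ≤ chernoffExponent (4 * √(L / m)) s V) ∨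
      ∃ m : ℕ, (m + 1) * L ≤ chernoffExponent (2 * (m + 1) * √((m + 1 + 1) * L)) s V := by
  rcases le_or_gt 1 n with h1 | h1
  · have hfloor : 1 ≤ ⌊n⌋₊ := Nat.le_floor (by simpa using h1)
    have hcast : (1 : ℝ) ≤ ⌊n⌋₊ := by exact_mod_cast hfloor
    have hlt := Nat.lt_floor_add_one n
    exact .inl ⟨⌊n⌋₊, Finset.mem_Icc.2 ⟨hfloor, Nat.floor_le_of_le hτ⟩,
      two_mul_le_chernoffExponent hL (by linarith) (Nat.floor_le hn.le) (by linarith) hV1 hs⟩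
  · have h1n : 1 ≤ 1 / n := (one_le_div hn).2 h1.le
    obtain ⟨m, hm⟩ := Nat.exists_eq_add_of_le' (Nat.le_floor (by simpa using h1n) : 1 ≤ ⌊1 / n⌋₊)
    have hle := Nat.floor_le (zero_le_one.trans h1n)
    have hlt := Nat.lt_floor_add_one (1 / n)
    rw [hm, le_div_iff₀ hn] at hle
    rw [hm, div_lt_iff₀ hn] at hlt
    push_cast at hle hlt
    exact .inr ⟨m, mul_le_chernoffExponent hL (by simp) hn.le hle hlt.le hV2 hs⟩

theorem two_mul_ofReal_exp_add_tsum_le {τ : ℕ} (hτ : 2 ≤ τ) :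
    τ * (2 * ENNReal.ofReal (Real.exp (-(2 * Real.log τ)))) +
      ∑' m : ℕ, 2 * ENNReal.ofReal (Real.exp (-((m + 1) * Real.log τ))) ≤
      ENNReal.ofReal (6 / τ) := by
  have hτ0 : (0 : ℝ) < τ := by positivity
  obtain ⟨q, hq⟩ : ∃ q : ℝ, q = (τ : ℝ)⁻¹ := ⟨_, rfl⟩
  have hq0 : 0 < q := hq ▸ inv_pos.2 hτ0
  have hq2 : q ≤ 1 / 2 := hq ▸ inv_le_of_inv_le₀ (by norm_num) (by norm_num; exact_mod_cast hτ)
  have hexp : ∀ c : ℝ, Real.exp (-(c * Real.log τ)) = q ^ c := fun c => by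
    rw [hq, Real.inv_rpow hτ0.le, Real.rpow_def_of_pos hτ0, ← Real.exp_neg, mul_comm]
  have htail : ∑' m : ℕ, 2 * q ^ (m + 1) ≤ 4 * q := by
    simp_rw [pow_succ', ← mul_assoc]
    rw [tsum_mul_left, tsum_geometric_of_lt_one hq0.le (by linarith), ← div_eq_mul_inv,
      div_le_iff₀ (by linarith)]
    nlinarith
  have hsum : Summable fun m : ℕ => 2 * q ^ (m + 1) :=
    ((summable_nat_add_iff 1).2 (summable_geometric_of_lt_one hq0.le (by linarith))).mul_left 2
  calc _ = ENNReal.ofReal (τ * (2 * q ^ 2)) + ∑' m : ℕ, ENNReal.ofReal (2 * q ^ (m + 1)) := by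
        rw [ENNReal.ofReal_mul hτ0.le, ENNReal.ofReal_natCast]
        simp only [hexp, ENNReal.ofReal_mul zero_le_two, ENNReal.ofReal_ofNat]
        norm_cast
    _ = ENNReal.ofReal (τ * (2 * q ^ 2) + ∑' m : ℕ, 2 * q ^ (m + 1)) := by
        rw [← ENNReal.ofReal_tsum_of_nonneg (fun m => by positivity) hsum,
          ← ENNReal.ofReal_add (by positivity) (by positivity)]
    _ ≤ ENNReal.ofReal (6 / τ) := by
        refine ENNReal.ofReal_le_ofReal ?_
        have hfirst : τ * (2 * q ^ 2) = 2 * q := by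
          rw [hq]
          field_simp
        rw [hfirst, div_eq_mul_inv, ← hq]
        linarith

variable {Ω : Type*} [MeasurableSpace Ω] {P : Measure Ω}

theorem measure_le_ofReal_exp_neg {X : Ω → ℝ} (hX : AEMeasurable X P)
    (h : ∫⁻ ω, ENNReal.ofReal (Real.exp (X ω)) ∂P ≤ 1) (r : ℝ) :
    P {ω | r ≤ X ω} ≤ ENNReal.ofReal (Real.exp (-r)) := by
  have hmarkov := mul_meas_ge_le_lintegral₀ hX.exp.ennreal_ofReal (ENNReal.ofReal (Real.exp r))
  simp only [ENNReal.ofReal_le_ofReal_iff (Real.exp_pos _).le, Real.exp_le_exp] at hmarkov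
  rw [Real.exp_neg, ENNReal.ofReal_inv_of_pos (Real.exp_pos _), ← one_div]
  refine ENNReal.le_div_iff_mul_le ?_ ?_ |>.2 ?_
  · exact .inl (by simp [Real.exp_pos])
  · exact .inl ENNReal.ofReal_ne_top
  · rw [mul_comm]
    exact hmarkov.trans h

variable {N V : Ω → ℝ}

theorem measure_le_two_mul_ofReal_exp_neg (hN : AEMeasurable N P) (hV : AEMeasurable V P)
    (h : ∀ θ : ℝ, ∫⁻ ω, ENNReal.ofReal (Real.exp (chernoffExponent θ (N ω) (V ω))) ∂P ≤ 1)
    (θ r : ℝ) :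
    P {ω | r ≤ chernoffExponent θ |N ω| (V ω)} ≤ 2 * ENNReal.ofReal (Real.exp (-r)) := by
  have hone : ∀ θ : ℝ, P {ω | r ≤ chernoffExponent θ (N ω) (V ω)} ≤
      ENNReal.ofReal (Real.exp (-r)) := fun θ =>
    measure_le_ofReal_exp_neg (by unfold chernoffExponent; fun_prop) (h θ) r
  rw [two_mul]
  refine (measure_mono fun ω hω => ?_).trans
    ((measure_union_le _ _).trans (add_le_add (hone θ) (hone (-θ))))
  rcases abs_choice (N ω) with hN | hN <;> rw [Set.mem_ofPred_eq, hN] at hω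
  · exact .inl hω
  · exact .inr (by simpa only [Set.mem_ofPred_eq, chernoffExponent, neg_sq, neg_mul, mul_neg]
      using hω)

theorem measure_lt_abs_le {n : Ω → ℝ} {τ : ℕ} (hN : AEMeasurable N P) (hV : AEMeasurable V P)
    (h : ∀ θ : ℝ, ∫⁻ ω, ENNReal.ofReal (Real.exp (chernoffExponent θ (N ω) (V ω))) ∂P ≤ 1)
    (hn : ∀ ω, 0 ≤ n ω) (hnτ : ∀ ω, n ω ≤ τ) (hV1 : ∀ ω, V ω ≤ n ω) (hV2 : ∀ ω, V ω ≤ n ω ^ 2)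
    (hzero : ∀ ω, n ω = 0 → N ω = 0) (hτ : 2 ≤ τ) :
    P {ω | 5 / 4 * √(Real.log τ * n ω) < |N ω|} ≤ ENNReal.ofReal (6 / τ) := by
  have htail := measure_le_two_mul_ofReal_exp_neg hN hV h
  set L := Real.log τ
  have hL : 0 ≤ L := Real.log_natCast_nonneg τ
  have hsub : {ω | 5 / 4 * √(L * n ω) < |N ω|} ⊆
      (⋃ m ∈ Finset.Icc 1 τ, {ω | 2 * L ≤ chernoffExponent (4 * √(L / m)) |N ω| (V ω)}) ∪
      ⋃ m : ℕ, {ω | (m + 1) * L ≤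
        chernoffExponent (2 * (m + 1) * √((m + 1 + 1) * L)) |N ω| (V ω)} := by
    intro ω hω
    have hpos : 0 < n ω := (hn ω).lt_of_ne' fun h0 => by
      rw [Set.mem_ofPred_eq, hzero ω h0, abs_zero] at hω
      exact hω.not_ge (by positivity)
    simpa only [Set.mem_union, Set.mem_iUnion, Set.mem_ofPred_eq, exists_prop] using
      exists_le_chernoffExponent hL hpos (hnτ ω) (hV1 ω) (hV2 ω) (le_of_lt hω)
  calc P {ω | 5 / 4 * √(L * n ω) < |N ω|}
      ≤ ∑ _m ∈ Finset.Icc 1 τ, 2 * ENNReal.ofReal (Real.exp (-(2 * L))) +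
        ∑' m : ℕ, 2 * ENNReal.ofReal (Real.exp (-((m + 1) * L))) :=
        (measure_mono hsub).trans <| (measure_union_le _ _).trans <| add_le_add
          ((measure_biUnion_finset_le _ _).trans (Finset.sum_le_sum fun _ _ => htail _ _))
          ((measure_iUnion_le _).trans (ENNReal.tsum_le_tsum fun _ => htail _ _))
    _ ≤ ENNReal.ofReal (6 / τ) := by
        simpa using two_mul_ofReal_exp_add_tsum_le hτ

end SelfNormalized

section Deviation

variable {K T : ℕ} {F : Environment K T} {a b : ℝ}

theorem lintegral_prod_exp_reward_le_one (hF : IsSubGaussianEnv a b F) (ρ : Policy K) (k : Fin K)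
    (c : Fin T → ℝ) (s : Finset (Fin T)) :
    ∫⁻ x, ∏ t ∈ s, (if ρ.arm x t = k then
      ENNReal.ofReal (Real.exp (c t * (x t k - mean F t k) - c t ^ 2 / 8)) else 1)
      ∂rewardLaw F ≤ 1 := by
  have hvar : ∀ l : ℝ, (1 / 4 : NNReal) * l ^ 2 / 2 = l ^ 2 / 8 := fun l => by push_cast; ring
  refine lintegral_prod_le_one _ (fun t => ?_) (fun t u htu x y => ?_) (fun t x => ?_) s
  · exact Measurable.ite (ρ.measurable_arm t (measurableSet_singleton k)) (by fun_prop)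
      measurable_const
  · rw [ρ.arm_update x y htu.le, Function.update_of_ne htu.ne]
  · simp only [ρ.arm_update x _ le_rfl, Function.update_self]
    split_ifs
    · rw [(measurePreserving_eval (fun k => (F t k : Measure ℝ)) k).lintegral_comp (f := fun y =>
        ENNReal.ofReal (Real.exp (c t * (y - mean F t k) - c t ^ 2 / 8))) (by fun_prop)]
      simpa only [hvar] using lintegral_exp_sub_le_one (hF t k).1 (c t)
    · simp

variable {γ : ℝ} {e t : ℕ}

theorem lintegral_exp_discountedNoise_le_one (hF : IsSubGaussianEnv a b F) (ρ : Policy K)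
    (k : Fin K) (ht : t ≤ T) (θ : ℝ) :
    ∫⁻ x, ENNReal.ofReal (Real.exp
      (chernoffExponent θ
        (discountedNoise γ e (fun s => mean F (s.castLE ht)) (ρ.history x t ht) k)
        (discountedCount (γ ^ 2) e (ρ.history x t ht) k))) ∂rewardLaw F ≤ 1 := by
  refine le_of_eq_of_le (lintegral_congr fun x => ?_) (lintegral_prod_exp_reward_le_one hF ρ k
    (fun s => θ * γ ^ (t - 1 - s + e)) (Finset.univ.map (Fin.castLEEmb ht)))
  rw [Finset.prod_map, chernoffExponent, discountedNoise, discountedCount_eq_sum,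
    Finset.mul_sum, Finset.mul_sum, Finset.sum_div, ← Finset.sum_sub_distrib, Real.exp_sum,
    ENNReal.ofReal_prod_of_nonneg fun _ _ => (Real.exp_pos _).le]
  refine Finset.prod_congr rfl fun s _ => ?_
  rw [discountedWeight_sq, discountedWeight, ρ.history_apply, Fin.castLEEmb_apply]
  split_ifs with hk
  · rw [Fin.val_castLE, mul_pow, mul_assoc, ← hk]
  · simp

variable (γ e) in
theorem measurable_discountedWeight (k : Fin K) (s : Fin t) :
    Measurable fun h : Fin t → Fin K × ℝ => discountedWeight γ e h k s :=
  Measurable.ite (measurable_fst.comp (measurable_pi_apply s) (measurableSet_singleton k))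
    measurable_const measurable_const

variable (γ e) in
theorem measurable_discountedCount (k : Fin K) :
    Measurable fun h : Fin t → Fin K × ℝ => discountedCount γ e h k :=
  Finset.measurable_sum _ fun s _ => measurable_discountedWeight γ e k s

variable (γ e) in
theorem measurable_discountedNoise (m : Fin t → Fin K → ℝ) (k : Fin K) :
    Measurable fun h : Fin t → Fin K × ℝ => discountedNoise γ e m h k :=
  Finset.measurable_sum _ fun s _ =>
    (measurable_discountedWeight γ e k s).mul (by fun_prop)

theorem discountedNoise_eq_zero (hγ : 0 ≤ γ) (m : Fin t → Fin K → ℝ) {h : Fin t → Fin K × ℝ}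
    {k : Fin K} (hn : discountedCount γ e h k = 0) : discountedNoise γ e m h k = 0 := by
  have hzero := (Finset.sum_eq_zero_iff_of_nonneg
    fun s _ => discountedWeight_nonneg (e := e) hγ h k s).1 hn
  exact Finset.sum_eq_zero fun s hs => by rw [hzero s hs, zero_mul]

/-- The event that at the beginning of slot `t` the noise of some arm exceeds the confidence
radius `5/4 √(n ln τ)`, where `n` is the discounted count of the arm. -/
def deviationEvent (γ : ℝ) (e τ : ℕ) (F : Environment K T) (ρ : Policy K) (t : Fin T) :
    Set (Fin T → Fin K → ℝ) :=
  ⋃ k, {x | 5 / 4 * √(Real.log τ * discountedCount γ e (ρ.history x t t.2.le) k) <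
    |discountedNoise γ e (fun s => mean F (s.castLE t.2.le)) (ρ.history x t t.2.le) k|}

theorem measurableSet_deviationEvent (τ : ℕ) (ρ : Policy K) (t : Fin T) :
    MeasurableSet (deviationEvent γ e τ F ρ t) := by
  refine MeasurableSet.iUnion fun k => measurableSet_lt ?_ ?_
  · exact ((((measurable_discountedCount γ e k).comp (ρ.measurable_history t.2.le)).const_mul
      _).sqrt).const_mul _
  · exact ((measurable_discountedNoise γ e _ k).comp (ρ.measurable_history t.2.le)).abs

theorem rewardLaw_deviationEvent_le (hF : IsSubGaussianEnv a b F) (ρ : Policy K) (hγ0 : 0 ≤ γ)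
    (hγ1 : γ < 1) {τ : ℕ} (hτ : 2 ≤ τ) (hγτ : 1 / (1 - γ) ≤ τ) (t : Fin T) :
    (rewardLaw F).real (deviationEvent γ e τ F ρ t) ≤ K * (6 / τ) := by
  have harm : ∀ k : Fin K, (rewardLaw F).real _ ≤ 6 / τ := fun k =>
    ENNReal.toReal_le_of_le_ofReal (by positivity) <| measure_lt_abs_le
      ((measurable_discountedNoise γ e _ k).comp (ρ.measurable_history t.2.le)).aemeasurable
      ((measurable_discountedCount (γ ^ 2) e k).comp
        (ρ.measurable_history t.2.le)).aemeasurable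
      (lintegral_exp_discountedNoise_le_one hF ρ k t.2.le)
      (fun x => discountedCount_nonneg hγ0 _ k)
      (fun x => (discountedCount_le hγ0 hγ1 _ k).trans hγτ)
      (fun x => discountedCount_sq_le hγ0 hγ1.le _ k)
      (fun x => discountedCount_sq_le_sq hγ0 _ k)
      (fun x => discountedNoise_eq_zero hγ0 _) hτ
  refine (measureReal_iUnion_fintype_le _).trans ((Finset.sum_le_sum fun k _ => harm k).trans ?_)
  simp

end Deviation

section RegretBound

variable {K T : ℕ} {F : Environment K T} {a b γ : ℝ} {e D τ : ℕ} {ξ : ℝ} {ρ : Policy K}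

theorem IsDiscountedUCB.bestMean_sub_mean_le_add_indicator (hρ : IsDiscountedUCB γ τ ξ e T ρ)
    (hF : IsSubGaussianEnv a b F) (hb : 0 < b) (hγ0 : 0 < γ) (hγ1 : γ < 1)
    (hD : γ ^ D / (1 - γ) ≤ (1 / (8 * b)) ^ 2) (hξ : 1 / 2 ≤ ξ) (hτ : 1 ≤ Real.log τ)
    (x : Fin T → Fin K → ℝ) (t : Fin T) :
    bestMean F t - mean F t (ρ.arm x t) ≤ 2 * windowVariation F D t +
      (6 * √(ξ * Real.log τ) + 2 * b) *
        (1 / √(discountedCount γ e (ρ.history x t t.2.le) (ρ.arm x t) + 1)) +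
      (deviationEvent γ e τ F ρ t).indicator (fun _ => b) x := by
  by_cases hx : x ∈ deviationEvent γ e τ F ρ t
  · rw [Set.indicator_of_mem hx]
    refine (hF.bestMean_sub_mean_le t _).trans (le_add_of_nonneg_left ?_)
    have := windowVariation_nonneg F D t
    positivity
  · rw [Set.indicator_of_notMem hx, add_zero]
    refine hρ.bestMean_sub_mean_le x t hF hb hγ0 hγ1 hD hξ hτ fun k => not_lt.1 fun hk => hx ?_
    exact Set.mem_iUnion.2 ⟨k, hk⟩

theorem IsDiscountedUCB.sum_bestMean_sub_mean_le (hρ : IsDiscountedUCB γ τ ξ e T ρ)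
    (hF : IsSubGaussianEnv a b F) (hb : 0 < b) (hγ0 : 1 / 2 ≤ γ) (hγ1 : γ < 1) (he : e ≤ 1)
    (hD : γ ^ D / (1 - γ) ≤ (1 / (8 * b)) ^ 2) (hξ : 1 / 2 ≤ ξ) (hτ : 1 ≤ Real.log τ)
    (x : Fin T → Fin K → ℝ) :
    ∑ t, (bestMean F t - mean F t (ρ.arm x t)) ≤ 2 * (D * totalVariation F) +
      (6 * √(ξ * Real.log τ) + 2 * b) * (4 * (√(K / (1 - γ)) + T * √(K * (1 - γ)))) +
      ∑ t, (deviationEvent γ e τ F ρ t).indicator (fun _ => b) x := by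
  have hcount : ∑ t : Fin T,
      1 / √(discountedCount γ e (ρ.history x t t.2.le) (ρ.arm x t) + 1) ≤
        4 * (√(K / (1 - γ)) + T * √(K * (1 - γ))) := by
    refine le_of_eq_of_le (Finset.sum_congr rfl fun t _ => ?_)
      (sum_one_div_sqrt_discountedCount_take_le hγ0 hγ1 he (ρ.history x T le_rfl))
    rw [← ρ.history_eq_take, ρ.history_apply]
    rfl
  refine (Finset.sum_le_sum fun t _ => hρ.bestMean_sub_mean_le_add_indicator hF hb
    (by linarith) hγ1 hD hξ hτ x t).trans ?_
  simp only [Finset.sum_add_distrib, ← Finset.mul_sum]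
  gcongr
  exact sum_windowVariation_le F D

theorem IsDiscountedUCB.regret_le (hρ : IsDiscountedUCB γ τ ξ e T ρ)
    (hF : IsSubGaussianEnv a b F) (hb : 0 < b) (hγ0 : 1 / 2 ≤ γ) (hγ1 : γ < 1) (he : e ≤ 1)
    (hD : γ ^ D / (1 - γ) ≤ (1 / (8 * b)) ^ 2) (hξ : 1 / 2 ≤ ξ) (hτ : 1 ≤ Real.log τ)
    (hγτ : 1 / (1 - γ) ≤ τ) :
    regret ρ F ≤ 2 * (D * totalVariation F) +
      (6 * √(ξ * Real.log τ) + 2 * b) * (4 * (√(K / (1 - γ)) + T * √(K * (1 - γ)))) +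
      T * (K * (6 / τ) * b) := by
  have hτ2 : 2 ≤ τ := by
    rw [← Nat.cast_le (α := ℝ)]
    exact hγτ.trans' ((le_div_iff₀ (by linarith)).2 (by push_cast; linarith))
  have hevent : ∀ t, Integrable ((deviationEvent γ e τ F ρ t).indicator fun _ => b)
      (rewardLaw F) := fun t => (integrable_const b).indicator (measurableSet_deviationEvent τ ρ t)
  have hsum := integrable_finsetSum Finset.univ fun t _ => hevent t
  rw [regret_eq_integral_gap ρ hF.integrable]
  refine (integral_mono (integrable_finsetSum _ fun t _ => integrable_gap ρ t)
    ((integrable_const _).add hsum)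
    (hρ.sum_bestMean_sub_mean_le hF hb hγ0 hγ1 he hD hξ hτ)).trans ?_
  simp only [Pi.add_apply]
  rw [integral_add (integrable_const _) hsum, integral_const, probReal_univ, one_smul,
    integral_finsetSum _ fun t _ => hevent t]
  gcongr
  calc ∑ t, ∫ x, (deviationEvent γ e τ F ρ t).indicator (fun _ => b) x ∂rewardLaw F
      ≤ ∑ _t : Fin T, K * (6 / τ) * b := by
        refine Finset.sum_le_sum fun t _ => ?_
        rw [integral_indicator_const b (measurableSet_deviationEvent τ ρ t), smul_eq_mul]
        exact mul_le_mul_of_nonneg_right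
          (rewardLaw_deviationEvent_le hF ρ (by linarith) hγ1 hτ2 hγτ t) hb.le
    _ = T * (K * (6 / τ) * b) := by simp

end RegretBound

section Rate

/-- The rate `(K V) ^ (1/3) T ^ (2/3)` of the regret. -/
def regretRate (K T : ℕ) (V : ℝ) : ℝ :=
  ((K : ℝ) * V) ^ (1 / 3 : ℝ) * (T : ℝ) ^ (2 / 3 : ℝ)

/-- The constant in front of `ln T` times the rate: `48 √ξ` comes from the exploration bonuses, the
logarithm from the length of the window, and `22 b` from small counts and deviation events. -/
def regretConstant (ξ b : ℝ) : ℝ :=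
  48 * √ξ + 2 * Real.log (1 + 64 * b ^ 2) + 4 + 22 * b

theorem log_one_add_sq_nonneg (b : ℝ) : 0 ≤ Real.log (1 + 64 * b ^ 2) :=
  Real.log_nonneg (le_add_of_nonneg_right (by positivity))

theorem mul_le_regretConstant (ξ : ℝ) {b : ℝ} : 22 * b ≤ regretConstant ξ b := by
  have := log_one_add_sq_nonneg b
  unfold regretConstant
  linarith [Real.sqrt_nonneg ξ]

theorem exists_pow_div_le {b d : ℝ} (hd0 : 0 < d) (hd1 : d ≤ 1) (hb : 0 < b) :
    ∃ D : ℕ, (1 - d) ^ D / d ≤ (1 / (8 * b)) ^ 2 ∧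
      D ≤ 1 / d * (Real.log (1 + 64 * b ^ 2) + Real.log (1 / d)) + 1 := by
  have hlogd := Real.log_nonneg ((one_le_div hd0).2 hd1)
  set l := Real.log (1 + 64 * b ^ 2) + Real.log (1 / d) with hl
  have hl0 : 0 ≤ l := add_nonneg (log_one_add_sq_nonneg b) hlogd
  refine ⟨⌈1 / d * l⌉₊, ?_, (Nat.ceil_lt_add_one (by positivity)).le⟩
  have hceil := Nat.le_ceil (1 / d * l)
  set D := ⌈1 / d * l⌉₊
  rw [one_div_mul_eq_div, div_le_iff₀' hd0] at hceil
  have hpow : (1 - d) ^ D ≤ d / (1 + 64 * b ^ 2) := by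
    calc (1 - d) ^ D ≤ Real.exp (-d) ^ D :=
          pow_le_pow_left₀ (by linarith) (Real.one_sub_le_exp_neg d) D
      _ = Real.exp (-(d * D)) := by rw [← Real.exp_nat_mul, mul_neg, mul_comm]
      _ ≤ Real.exp (-l) := Real.exp_le_exp.2 (neg_le_neg hceil)
      _ = d / (1 + 64 * b ^ 2) := by
          rw [hl, Real.exp_neg, Real.exp_add, Real.exp_log (by positivity),
            Real.exp_log (by positivity)]
          field_simp
  calc (1 - d) ^ D / d ≤ d / (1 + 64 * b ^ 2) / d := by gcongr
    _ = 1 / (1 + 64 * b ^ 2) := by field_simp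
    _ ≤ 1 / (64 * b ^ 2) := one_div_le_one_div_of_le (by positivity) (by linarith)
    _ = (1 / (8 * b)) ^ 2 := by ring

variable {K T : ℕ} {V : ℝ}

theorem one_sub_discount_pos (hK : 0 < K) (hT : 0 < T) (hV : 0 < V) :
    0 < 1 - discount K T V := by
  rw [discount, sub_sub_cancel]
  positivity

theorem one_div_one_sub_discount (hV : 0 ≤ V) :
    1 / (1 - discount K T V) = (K : ℝ) ^ (1 / 3 : ℝ) * ((T : ℝ) / V) ^ (2 / 3 : ℝ) := by
  rw [discount, sub_sub_cancel, Real.rpow_neg (by positivity), Real.rpow_neg (by positivity),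
    one_div, mul_inv, inv_inv, inv_inv]

theorem one_div_one_sub_discount_le_epochLength (hV : 0 ≤ V) :
    1 / (1 - discount K T V) ≤ epochLength K T V :=
  one_div_one_sub_discount hV ▸ Nat.le_ceil _

theorem rpow_one_third_pow_three {y : ℝ} (hy : 0 ≤ y) : (y ^ (1 / 3 : ℝ)) ^ 3 = y := by
  rw [← Real.rpow_mul_natCast hy]
  norm_num

theorem rpow_two_thirds_pow_three {y : ℝ} (hy : 0 ≤ y) : (y ^ (2 / 3 : ℝ)) ^ 3 = y ^ 2 := by
  rw [← Real.rpow_mul_natCast hy]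
  norm_num

theorem mul_one_sub_discount_pow_three (hK : 0 < K) (hT : 0 < T) (hV : 0 < V) :
    K * T ^ 2 * (1 - discount K T V) ^ 3 = V ^ 2 := by
  have hd := one_sub_discount_pos hK hT hV
  have hinv : (1 / (1 - discount K T V)) ^ 3 = K * (T / V) ^ 2 := by
    rw [one_div_one_sub_discount hV.le, mul_pow, rpow_one_third_pow_three (by positivity),
      rpow_two_thirds_pow_three (by positivity)]
  rw [div_pow, one_pow, div_pow, mul_div_assoc', div_eq_div_iff (by positivity) (by positivity)]
    at hinv
  linarith

theorem regretRate_eq_div (hK : 0 < K) (hT : 0 < T) (hV : 0 < V) :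
    regretRate K T V = V / (1 - discount K T V) := by
  have hd := one_sub_discount_pos hK hT hV
  have hcube := mul_one_sub_discount_pow_three hK hT hV
  refine (pow_left_inj₀ (by unfold regretRate; positivity) (by positivity) three_ne_zero).1 ?_
  rw [regretRate, mul_pow, rpow_one_third_pow_three (by positivity),
    rpow_two_thirds_pow_three (by positivity), div_pow, eq_div_iff (by positivity)]
  linear_combination V * hcube

theorem regretRate_eq_mul_sqrt (hK : 0 < K) (hT : 0 < T) (hV : 0 < V) :
    regretRate K T V = T * √(K * (1 - discount K T V)) := by
  have hd := one_sub_discount_pos hK hT hV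
  have hcube := mul_one_sub_discount_pow_three hK hT hV
  have hsq : V / (1 - discount K T V) = √(T ^ 2 * (K * (1 - discount K T V))) := by
    rw [eq_comm, Real.sqrt_eq_iff_eq_sq (by positivity) (by positivity), div_pow,
      eq_div_iff (by positivity)]
    linear_combination hcube
  rw [regretRate_eq_div hK hT hV, hsq, Real.sqrt_mul (by positivity), Real.sqrt_sq (by positivity)]

end Rate

section Tuning

variable {K T d V b ξ τ M : ℝ}

theorem mul_variation_le {l D W : ℝ} (hd0 : 0 < d) (hd1 : d ≤ 1) (hdT : 1 / d ≤ T) (hV : 0 ≤ V)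
    (hM : M = V / d) (hD0 : 0 ≤ D) (hD : D ≤ 1 / d * (l + Real.log (1 / d)) + 1) (hW : W ≤ V) :
    D * W ≤ M * (l + Real.log T) + M := by
  have hlog : Real.log (1 / d) ≤ Real.log T := Real.log_le_log (by positivity) hdT
  calc D * W ≤ D * V := mul_le_mul_of_nonneg_left hW hD0
    _ ≤ (1 / d * (l + Real.log T) + 1) * V :=
        mul_le_mul_of_nonneg_right (hD.trans (by gcongr)) hV
    _ = V / d * (l + Real.log T) + V := by ring
    _ ≤ M * (l + Real.log T) + M := by
        rw [hM]
        gcongr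
        exact le_div_self hV hd0 hd1

theorem exploration_le (hd : 0 < d) (hb : 0 ≤ b) (hξ : 0 ≤ ξ) (hdT : 1 / d ≤ T)
    (hτ : 1 ≤ Real.log τ) (hτT : Real.log τ ≤ Real.log T) (hM : M = T * √(K * d)) :
    (6 * √(ξ * Real.log τ) + 2 * b) * (4 * (√(K / d) + T * √(K * d))) ≤
      (6 * (√ξ * Real.log T) + 2 * b) * (8 * M) := by
  have hbonus : √(ξ * Real.log τ) ≤ √ξ * Real.log T := by
    rw [Real.sqrt_mul hξ]
    gcongr
    exact (Real.sqrt_le_self_iff.2 (.inr hτ)).trans hτT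
  have hroot : √(K / d) ≤ M := by
    calc √(K / d) = 1 / d * √(K * d) := by
          rw [show K / d = (1 / d) ^ 2 * (K * d) by field_simp, Real.sqrt_mul (by positivity),
            Real.sqrt_sq (by positivity)]
      _ ≤ M := by rw [hM]; gcongr
  have hM0 : 0 ≤ M := (Real.sqrt_nonneg _).trans hroot
  rw [← hM]
  exact mul_le_mul (by linarith) (by linarith) (by positivity)
    ((by positivity : 0 ≤ 6 * √(ξ * Real.log τ) + 2 * b).trans (by linarith))

theorem failure_le (hT : 0 ≤ T) (hK : 0 ≤ K) (hb : 0 ≤ b) (hd : 0 < d) (hdτ : 1 / d ≤ τ)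
    (hsmall : √(K * d) ≤ 1) (hM : M = T * √(K * d)) : T * (K * (6 / τ) * b) ≤ 6 * b * M := by
  have hτd : 1 / τ ≤ d := (one_div_le ((one_div_pos.2 hd).trans_le hdτ) hd).2 hdτ
  have hKd : K * d ≤ √(K * d) := by
    calc K * d = √(K * d) * √(K * d) := (Real.mul_self_sqrt (by positivity)).symm
      _ ≤ √(K * d) := mul_le_of_le_one_left (Real.sqrt_nonneg _) hsmall
  calc T * (K * (6 / τ) * b) = 6 * b * (T * (K * (1 / τ))) := by ring
    _ ≤ 6 * b * (T * (K * d)) := by gcongr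
    _ ≤ 6 * b * M := by rw [hM]; gcongr

end Tuning

section Conclusion

variable {K T : ℕ} {F : Environment K T} {a b ξ V : ℝ} {e : ℕ} {ρ : Policy K}

theorem regret_le_of_le_sqrt (hF : IsSubGaussianEnv a b F) (hb : 0 < b) (hK : 1 ≤ K) (hT : 2 ≤ T)
    (hV : 0 < V) (hlarge : 1 / 8 ≤ √(K * (1 - discount K T V))) :
    regret ρ F ≤ regretConstant ξ b * Real.log T * regretRate K T V := by
  have hlog : 1 / 2 ≤ Real.log T := by
    have : Real.log 2 ≤ Real.log T := Real.log_le_log two_pos (by exact_mod_cast hT)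
    linarith [Real.log_two_gt_d9]
  have hrate := regretRate_eq_mul_sqrt hK (by omega : 0 < T) hV
  have hC := mul_le_regretConstant ξ (b := b)
  calc regret ρ F ≤ b * T := regret_le_mul ρ hF
    _ = 8 * b * (T * (1 / 8)) := by ring
    _ ≤ 8 * b * regretRate K T V := by rw [hrate]; gcongr
    _ ≤ regretConstant ξ b * Real.log T * regretRate K T V :=
        mul_le_mul_of_nonneg_right (by nlinarith) (hrate ▸ by positivity)

theorem IsDUCB.regret_le_of_sqrt_lt (hρ : IsDUCB T V ξ e ρ) (hF : F ∈ variationClass a b V T K)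
    (hb : 0 < b) (hξ : 1 / 2 ≤ ξ) (hK : 1 ≤ K) (hT : 0 < T) (hV : 0 < V) (he : e ≤ 1)
    (hτT : epochLength K T V ≤ T) (hsmall : √(K * (1 - discount K T V)) < 1 / 8) :
    regret ρ F ≤ regretConstant ξ b * Real.log T * regretRate K T V := by
  have hd0 := one_sub_discount_pos hK hT hV
  have hdτ := one_div_one_sub_discount_le_epochLength (K := K) (T := T) hV.le
  have hdiv := regretRate_eq_div hK hT hV
  have hmul := regretRate_eq_mul_sqrt hK hT hV
  have hρ' : IsDiscountedUCB (discount K T V) (epochLength K T V) ξ e T ρ := hρ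
  set γ := discount K T V
  set τ := epochLength K T V
  have hd : 1 - γ ≤ 1 / 64 := by
    have hKd : K * (1 - γ) < (1 / 8) ^ 2 := (Real.sqrt_lt' (by norm_num)).1 hsmall
    have : (1 : ℝ) ≤ K := by exact_mod_cast hK
    nlinarith
  have hτT' : (τ : ℝ) ≤ T := by exact_mod_cast hτT
  have hτ64 : (64 : ℝ) ≤ τ := hdτ.trans' ((le_div_iff₀ hd0).2 (by linarith))
  have hτ : 1 ≤ Real.log τ := by
    rw [Real.le_log_iff_exp_le (by linarith)]
    linarith [Real.exp_one_lt_three]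
  have hlogT : Real.log τ ≤ Real.log T := Real.log_le_log (by linarith) hτT'
  obtain ⟨D, hD, hD'⟩ := exists_pow_div_le hd0 (by linarith) hb
  rw [sub_sub_cancel] at hD
  have hregret := hρ'.regret_le hF.1 hb (by linarith) (by linarith) he hD hξ hτ hdτ
  have hvar := mul_variation_le hd0 (by linarith) (hdτ.trans hτT') hV.le hdiv D.cast_nonneg hD'
    hF.2
  have hexpl := exploration_le hd0 hb.le (by linarith : 0 ≤ ξ) (hdτ.trans hτT') hτ hlogT hmul
  have hfail := failure_le T.cast_nonneg K.cast_nonneg hb.le hd0 hdτ (by linarith) hmul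
  have hM : 0 ≤ regretRate K T V := hmul ▸ by positivity
  have hcoef := mul_nonneg (by linarith : 0 ≤ Real.log T - 1) (mul_nonneg hM (by
    linarith [log_one_add_sq_nonneg b] : 0 ≤ 2 * Real.log (1 + 64 * b ^ 2) + 2 + 22 * b))
  unfold regretConstant
  linarith

end Conclusion

end

end Bandit

/-- The worst-case regret of Discounted UCB over the sub-Gaussian environments with variation
budget `V` is at most `C ln T (K V) ^ (1/3) T ^ (2/3)`, where `C` depends only on the exploration
constant `ξ` and on the length `b` of the interval of means. -/
theorem theorem3 (ξ : ℝ) (hξ : 1 / 2 < ξ) (b : ℝ) (hb : 0 < b) :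
    ∃ C : ℝ, 0 < C ∧
      ∀ (K T : ℕ) (V a : ℝ), 1 ≤ K → 2 ≤ T → 0 < V → Bandit.epochLength K T V ≤ T →
        ∀ e : ℕ, e ≤ 1 → ∀ ρ : Bandit.Policy K, Bandit.IsDUCB T V ξ e ρ →
          Bandit.worstCaseRegret a b V T K ρ ≤
            ((C * Real.log T * ((K : ℝ) * V) ^ (1 / 3 : ℝ) * (T : ℝ) ^ (2 / 3 : ℝ) : ℝ) :
              EReal) := by
  refine ⟨Bandit.regretConstant ξ b,
    (by positivity : 0 < 22 * b).trans_le (Bandit.mul_le_regretConstant ξ), ?_⟩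
  intro K T V a hK hT hV hτT e he ρ hρ
  refine iSup₂_le fun F hF => EReal.coe_le_coe_iff.2 ?_
  rw [mul_assoc _ (((K : ℝ) * V) ^ (1 / 3 : ℝ))]
  rcases le_or_gt (1 / 8) √(K * (1 - Bandit.discount K T V)) with hlarge | hsmall
  · exact Bandit.regret_le_of_le_sqrt hF.1 hb hK hT hV hlarge
  · exact hρ.regret_le_of_sqrt_lt hF hb hξ.le hK (by omega) hV he hτT hsmall
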